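/- Let $X$ be a Tychonoff space and let $\lambda$ be a cover of $X$ by subsets. Let $C_{\lambda,\rho}(X)$ be the set of continuous functions $X\to\mathbb R$ with the topology of uniform convergence on the members of $\lambda$, i.e. the topology of the uniformity generated by the sets $\{(f,g):\forall x\in A,\ (f(x),g(x))\in M\}$, where $A\in\lambda$ and $M$ is an entourage of $\mathbb R$ with its usual metric $\rho$. A set is pseudocompact if every continuous real-valued function on it (as a subspace) is bounded, and $\sigma$-pseudocompact if it is a countable union of pseudocompact subspaces. Let $\gamma_p$ be the family of all subspaces of $X$ that have a dense $\sigma$-pseudocompact subset. For $A\subseteq X$ and $x\in\overline A\setminus A$, consider the following game: at step $n\in\mathbb N$ player ONE chooses a neighbourhood $V_n$ of $x$, and then player TWO chooses a set $S_n\subseteq A$ contained in $\overline{T_n}$ for some $T_n\in\gamma_p$; TWO wins if $\overline{\bigcup_n S_n}\cap\bigcap_n V_n\neq\emptyset$, and otherwise ONE wins. The space $X$ is an $AV_{\gamma_p}$-space if for every non-closed $A\subseteq X$ there is $x\in\overline A\setminus A$ for which TWO has a winning strategy. The space $X$ is functionally generated by $\gamma_p$ if for every discontinuous $f:X\to\mathbb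 R$ there is $A\in\gamma_p$ such that $f|_A$ does not extend to a continuous real-valued function on $X$. Suppose that $X$ is an $AV_{\gamma_p}$-space or is functionally generated by $\gamma_p$. Then every countably pracompact subset $F$ of $C_{\lambda,\rho}(X)$ is relatively compact, i.e. has compact closure in $C_{\lambda,\rho}(X)$. Here $F$ is countably pracompact if there is $Y\subseteq F$, dense in $F$, such that every infinite subset of $Y$ has a limit point in $F$. -/

import Mathlib

open Set Filter Topology Uniformity

namespace AsanovVelichko

section Spaces

variable {X : Type*} [TopologicalSpace X]

/-- `A` is relatively compact in the ambient space: its closure is compact. -/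
def RelativelyCompact (A : Set X) : Prop :=
  IsCompact (closure A)

/-- `A` is pseudocompact: every continuous real-valued function on the subspace `A` is bounded. -/
def Pseudocompact (A : Set X) : Prop :=
  ∀ f : C(A, ℝ), Bornology.IsBounded (range f)

/-- `A` is σ-pseudocompact: a countable union of pseudocompact subspaces
(the empty set is pseudocompact, so a sequence of pieces covers finite families too). -/
def SigmaPseudocompact (A : Set X) : Prop :=
  ∃ P : ℕ → Set X, (∀ n, Pseudocompact (P n)) ∧ A = ⋃ n, P n

/-- The subspace `F` is countably pracompact: there is `Y ⊆ F`, dense in `F`, such that every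
infinite subset of `Y` has a limit point in `F`. -/
def CountablyPracompact (F : Set X) : Prop :=
  ∃ Y : Set X, Y ⊆ F ∧ F ⊆ closure Y ∧
    ∀ A : Set X, A ⊆ Y → A.Infinite → ∃ x ∈ F, AccPt x (𝓟 A)

variable (X) in
/-- The family of all subspaces of `X` that have a dense σ-pseudocompact subset. -/
def gammaP : Set (Set X) :=
  {Z | ∃ D : Set X, D ⊆ Z ∧ Z ⊆ closure D ∧ SigmaPseudocompact D}

/-- `σ` is a winning strategy of player TWO in the Asanov–Velichko game generated by the family
`Λ`, played on the set `A` at the point `x`. At step `n` player ONE plays a neighbourhood `V n`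
of `x`; TWO answers with `S n = σ n (V 0, …, V n)`, which must be a subset of `A` lying in the
closure of some member of `Λ`. TWO wins if the closure of `⋃ n, S n` meets `⋂ n, V n`. -/
def IsWinningForTwo (Λ : Set (Set X)) (A : Set X) (x : X)
    (σ : (n : ℕ) → (Fin (n + 1) → Set X) → Set X) : Prop :=
  ∀ V : ℕ → Set X, (∀ n, V n ∈ 𝓝 x) →
    (∀ n, σ n (fun i => V i) ⊆ A ∧ ∃ T ∈ Λ, σ n (fun i => V i) ⊆ closure T) ∧
      (closure (⋃ n, σ n (fun i => V i)) ∩ ⋂ n, V n).Nonempty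

variable (X) in
/-- `X` is an `AV_Λ`-space: for every non-closed `A ⊆ X` there is `x ∈ closure A \ A` for which
player TWO has a winning strategy. -/
def IsAVSpace (Λ : Set (Set X)) : Prop :=
  ∀ A : Set X, ¬ IsClosed A → ∃ x ∈ closure A \ A, ∃ σ, IsWinningForTwo Λ A x σ

variable (X) in
/-- `X` is functionally generated by `Λ`: for every discontinuous `f : X → ℝ` there is `A ∈ Λ`
such that `f` restricted to `A` has no extension to a continuous real-valued function on `X`. -/
def FunctionallyGenerated (Λ : Set (Set X)) : Prop :=
  ∀ f : X → ℝ, ¬ Continuous f → ∃ A ∈ Λ, ¬ ∃ g : C(X, ℝ), EqOn g f A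

end Spaces

/-- The set of continuous real-valued functions on `X`, as a type carrying the topology of
uniform convergence on the members of `Λ`. -/
def CUnif (X : Type*) [TopologicalSpace X] (_Λ : Set (Set X)) : Type _ := C(X, ℝ)

/-- The uniformity of uniform convergence on the members of `Λ`, for the usual metric of `ℝ`:
it is generated by the sets `{(f, g) | ∀ x ∈ A, (f x, g x) ∈ M}`, `A ∈ Λ`, `M ∈ 𝓤 ℝ`. -/
instance (X : Type*) [TopologicalSpace X] (Λ : Set (Set X)) : UniformSpace (CUnif X Λ) :=
  UniformSpace.comap (fun f : C(X, ℝ) => UniformOnFun.ofFun Λ (f : X → ℝ)) inferInstance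

end AsanovVelichko

namespace AsanovVelichko

section Pointwise

variable {X : Type*} [TopologicalSpace X]

/-! Let `Y` be the dense subset of `F` from countable pracompactness. Its sequences cluster, so `Y`
is pointwise bounded and every ultrafilter on `Y` has a pointwise limit `f`. Three facts give the
theorem.

`f` is continuous. Choose `h n` in `Y` approximating `f` on finite sets that depend on the earlier
`h k`; a continuous cluster point `g` then equals `f` on those sets. If they are finer and finer
nets of a pseudocompact `P` for `f` and the earlier functions, a limit argument gives `f = g` on
`P`, and one sequence serves countably many `P` (`exists_history_clusterPt`). Functional generation
or the game turns this into continuity on `X`.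

The ultrafilter converges uniformly on each member of `Λ`. Otherwise a sequence of functions far
from `f`, which later approximate `f` at the earlier witnesses, would have no cluster point
(`CUnif.exists_ultrafilter_le_nhds`).

In a regular space, convergence of all ultrafilters on `Y` makes `closure Y` compact. -/

/-- `f` lies in the closure of `Y` for the topology of pointwise convergence. -/
def PointwiseApprox (Y : Set C(X, ℝ)) (f : X → ℝ) : Prop :=
  ∀ E : Finset X, ∀ ε > 0, ∃ h ∈ Y, ∀ x ∈ E, |h x - f x| < ε

/-- Every sequence in `Y` has a continuous pointwise cluster point. -/
def PointwiseSeqClustering (Y : Set C(X, ℝ)) : Prop :=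
  ∀ h : ℕ → C(X, ℝ), (∀ n, h n ∈ Y) →
    ∃ g : C(X, ℝ), MapClusterPt (g : X → ℝ) atTop (fun n => (h n : X → ℝ))

/-! ### Pseudocompact sets seen through countably many continuous functions. -/

/-- The image of `P` in the metrizable space `ι → ℝ` is bounded in each coordinate, so a subsequence
converges to some `z`. If `z` were not in the image, the reciprocal of the distance to `z` would be
continuous and unbounded on `P`. -/
theorem Pseudocompact.exists_subseq_tendsto {ι : Type*} [Countable ι] {P : Set X}
    (hP : Pseudocompact P) (φ : ι → C(P, ℝ)) (x : ℕ → P) :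
    ∃ y : P, ∃ ψ : ℕ → ℕ, StrictMono ψ ∧
      ∀ i, Tendsto (fun n => φ i (x (ψ n))) atTop (𝓝 (φ i y)) := by
  have hK : IsCompact (univ.pi fun i => closure (range (φ i))) :=
    isCompact_univ_pi fun i => (hP (φ i)).isCompact_closure
  obtain ⟨z, -, ψ, hψ, hz⟩ := hK.tendsto_subseq (x := fun n i => φ i (x n))
    fun n i _ => subset_closure (mem_range_self _)
  let _ : MetricSpace (ι → ℝ) := TopologicalSpace.metrizableSpaceMetric (ι → ℝ)
  have hc : Continuous fun y : P => (fun i => φ i y : ι → ℝ) :=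
    continuous_pi fun i => (φ i).continuous
  by_cases hy : ∃ y : P, (fun i => φ i y) = z
  · obtain ⟨y, rfl⟩ := hy
    exact ⟨y, ψ, hψ, fun i => (tendsto_pi_nhds.1 hz) i⟩
  · push Not at hy
    have hd : ∀ y : P, dist (fun i => φ i y) z ≠ 0 := fun y => dist_ne_zero.2 (hy y)
    obtain ⟨M, hM⟩ := (hP ⟨fun y => (dist (fun i => φ i y) z)⁻¹,
      (hc.dist continuous_const).inv₀ hd⟩).exists_norm_le
    have hM' : ∀ y : P, (dist (fun i => φ i y) z)⁻¹ ≤ M := fun y =>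
      (le_abs_self _).trans (hM _ (mem_range_self y))
    have h0 := (tendsto_iff_dist_tendsto_zero.1 hz).eventually
      (gt_mem_nhds (show (0 : ℝ) < (|M| + 1)⁻¹ by positivity))
    obtain ⟨n, hn⟩ := h0.exists
    have hpos : 0 < dist (fun i => φ i (x (ψ n))) z := lt_of_le_of_ne dist_nonneg (hd _).symm
    have := (lt_inv_comm₀ hpos (by positivity)).1 hn
    have := hM' (x (ψ n))
    have := le_abs_self M
    linarith

theorem Pseudocompact.exists_finset_net {ι : Type*} [Finite ι] {P : Set X}
    (hP : Pseudocompact P) (φ : ι → C(P, ℝ)) {ε : ℝ} (hε : 0 < ε) :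
    ∃ E : Finset X, ∀ y : P, ∃ x : P, (x : X) ∈ E ∧ ∀ i, |φ i x - φ i y| < ε := by
  classical
  have := Fintype.ofFinite ι
  rcases isEmpty_or_nonempty P with hP' | hP'
  · exact ⟨∅, fun y => (hP'.false y).elim⟩
  have hb : TotallyBounded (range fun (y : P) i => φ i y) :=
    (isCompact_univ_pi fun i => (hP (φ i)).isCompact_closure).totallyBounded.subset <| by
      rintro _ ⟨y, rfl⟩ i -
      exact subset_closure (mem_range_self _)
  obtain ⟨t, ht, hf, hcov⟩ := Metric.finite_approx_of_totallyBounded hb ε hε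
  have ht' : ∀ z, ∃ y : P, z ∈ t → (fun i => φ i y) = z := fun z => by
    by_cases hz : z ∈ t
    · obtain ⟨y, hy⟩ := ht hz
      exact ⟨y, fun _ => hy⟩
    · exact ⟨Classical.arbitrary P, fun h => (hz h).elim⟩
  choose u hu using ht'
  refine ⟨hf.toFinset.image fun z => (u z : X), fun y => ?_⟩
  obtain ⟨z, hz, hyz⟩ := mem_iUnion₂.1 (hcov (mem_range_self y))
  refine ⟨u z, Finset.mem_image.2 ⟨z, hf.mem_toFinset.2 hz, rfl⟩, fun i => ?_⟩
  have h1 := (dist_pi_lt_iff hε).1 (Metric.mem_ball.1 hyz) i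
  have h2 : φ i (u z) = z i := congrFun (hu z hz) i
  rw [h2, abs_sub_comm]
  exact h1

/-! ### Sequences built on their histories, and their cluster points. -/

/-- A sequence chosen by recursion on its history `H n = [h (n - 1), …, h 0]`, approximating `f`
on the finite sets that `E` assigns to the earlier histories. -/
theorem exists_history {Y : Set C(X, ℝ)} {f : X → ℝ} (hf : PointwiseApprox Y f)
    (E : List C(X, ℝ) → Finset X) :
    ∃ (h : ℕ → C(X, ℝ)) (H : ℕ → List C(X, ℝ)), (∀ n, h n ∈ Y) ∧ H 0 = [] ∧
      (∀ n, H (n + 1) = h n :: H n) ∧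
      ∀ n, ∀ j ≤ n, ∀ x ∈ E (H j), |h n x - f x| < 1 / ((n : ℝ) + 1) := by
  classical
  -- The newest function heads the list, so the earlier histories are exactly the tails.
  have key : ∀ l : List C(X, ℝ), ∃ φ ∈ Y, ∀ l' ∈ l.tails, ∀ x ∈ E l',
      |φ x - f x| < 1 / ((l.length : ℝ) + 1) := fun l => by
    obtain ⟨φ, hφ, h⟩ := hf (l.tails.toFinset.biUnion E) (1 / ((l.length : ℝ) + 1))
      (by positivity)
    exact ⟨φ, hφ, fun l' hl' x hx => h x (Finset.mem_biUnion.2 ⟨l', by simpa using hl', hx⟩)⟩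
  choose step hY hstep using key
  let H : ℕ → List C(X, ℝ) := fun n => Nat.rec [] (fun _ l => step l :: l) n
  have hlen : ∀ n, (H n).length = n := fun n => by
    induction n with
    | zero => rfl
    | succ n ih => exact congrArg (· + 1) ih
  have hsuf : ∀ n, ∀ j ≤ n, H j <:+ H n := fun n j hj => by
    induction n, hj using Nat.le_induction with
    | base => exact List.suffix_rfl
    | succ n _ ih => exact ih.trans (List.suffix_cons _ _)
  refine ⟨fun n => step (H n), H, fun n => hY _, rfl, fun _ => rfl, fun n j hj x hx => ?_⟩
  have := hstep (H n) (H j) ((List.mem_tails _ _).2 (hsuf n j hj)) x hx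
  rwa [hlen] at this

theorem history_length {h : ℕ → C(X, ℝ)} {H : ℕ → List C(X, ℝ)} (h0 : H 0 = [])
    (hs : ∀ n, H (n + 1) = h n :: H n) (n : ℕ) : (H n).length = n := by
  induction n with
  | zero => simp [h0]
  | succ n ih => simp [hs, ih]

theorem mem_history {h : ℕ → C(X, ℝ)} {H : ℕ → List C(X, ℝ)}
    (hs : ∀ n, H (n + 1) = h n :: H n) {k n : ℕ} (hkn : k < n) : h k ∈ H n := by
  induction n, hkn using Nat.le_induction with
  | base => simp [hs]
  | succ n _ ih => simp [hs, ih]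

theorem history_drop {h : ℕ → C(X, ℝ)} {H : ℕ → List C(X, ℝ)}
    (hs : ∀ n, H (n + 1) = h n :: H n) (n i : ℕ) : (H (n + i)).drop i = H n := by
  induction i with
  | zero => simp
  | succ i ih => rw [← add_assoc, hs, List.drop_succ_cons, ih]

theorem tendsto_of_eventually_approx {h : ℕ → C(X, ℝ)} {f : X → ℝ} {x : X} {j : ℕ}
    (hx : ∀ n ≥ j, |h n x - f x| < 1 / ((n : ℝ) + 1)) :
    Tendsto (fun n => h n x) atTop (𝓝 (f x)) := by
  rw [tendsto_iff_dist_tendsto_zero]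
  refine squeeze_zero' (Eventually.of_forall fun _ => dist_nonneg) ?_
    tendsto_one_div_add_atTop_nhds_zero_nat
  filter_upwards [eventually_ge_atTop j] with n hn using (hx n hn).le

theorem mapClusterPt_apply_eq_of_tendsto {h : ℕ → C(X, ℝ)} {g : X → ℝ}
    (hg : MapClusterPt g atTop (fun n => (h n : X → ℝ))) {x : X} {c : ℝ}
    (hx : Tendsto (fun n => h n x) atTop (𝓝 c)) : g x = c := by
  have h1 : MapClusterPt (g x) atTop (fun n => h n x) :=
    hg.continuousAt_comp (f := fun u : X → ℝ => u x) (continuous_apply x).continuousAt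
  have : (𝓝 (g x) ⊓ 𝓝 c).NeBot := h1.neBot.mono (inf_le_inf_left _ hx)
  exact eq_of_nhds_neBot this

/-- Points that no `h n` separates are not separated by a cluster point: this carries values of `g`
from a limit point to the point of interest. -/
theorem mapClusterPt_apply_eq_apply {h : ℕ → C(X, ℝ)} {g : X → ℝ}
    (hg : MapClusterPt g atTop (fun n => (h n : X → ℝ))) {x y : X}
    (hxy : ∀ n, h n x = h n y) : g x = g y := by
  have h1 : MapClusterPt (g x - g y) atTop (fun n => h n x - h n y) :=
    hg.continuousAt_comp (f := fun u : X → ℝ => u x - u y)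
      (by fun_prop : Continuous fun u : X → ℝ => u x - u y).continuousAt
  simp only [hxy, sub_self] at h1
  have : (𝓝 (g x - g y) ⊓ 𝓝 0).NeBot :=
    h1.neBot.mono (inf_le_inf_left _ tendsto_const_nhds)
  exact sub_eq_zero.1 (eq_of_nhds_neBot this)

/-! ### Agreement of pointwise limits with continuous functions. -/

/-- Pointwise limits of `Y` are continuous on pseudocompact subspaces. -/
theorem PointwiseApprox.continuousOn {Y : Set C(X, ℝ)} {f : X → ℝ} (hf : PointwiseApprox Y f)
    (hY : PointwiseSeqClustering Y) {P : Set X} (hP : Pseudocompact P) : ContinuousOn f P := by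
  classical
  rw [continuousOn_iff_continuous_domRestrict, continuous_iff_continuousAt]
  intro p
  by_contra hcont
  rw [Metric.continuousAt_iff'] at hcont
  push Not at hcont
  obtain ⟨ε, hε, hfar⟩ := hcont
  -- Points that `f` keeps away from `p`, although the functions chosen so far hardly separate them
  -- from `p`.
  have key : ∀ l : List C(X, ℝ), ∃ a : P, ε ≤ dist (f a) (f p) ∧
      ∀ φ ∈ l, |φ a - φ p| < 1 / ((l.length : ℝ) + 1) := fun l => by
    have hnear : ∀ᶠ a : P in 𝓝 p, ∀ φ ∈ l, |φ a - φ p| < 1 / ((l.length : ℝ) + 1) := by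
      have : ∀ φ ∈ l.toFinset, ∀ᶠ a : P in 𝓝 p, |φ a - φ p| < 1 / ((l.length : ℝ) + 1) := by
        intro φ _
        have hc : ContinuousAt (fun a : P => φ a) p := by fun_prop
        exact (Metric.continuousAt_iff'.1 hc) _ (by positivity)
      simpa using (Filter.eventually_all_finset _).2 this
    obtain ⟨a, ha, ha'⟩ := (hfar.and_eventually hnear).exists
    exact ⟨a, by simpa using ha, ha'⟩
  choose a hafar hanear using key
  obtain ⟨h, H, hhY, h0, hs, happ⟩ := exists_history hf (fun l => {(a l : X), (p : X)})
  obtain ⟨g, hg⟩ := hY h hhY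
  have hgf : ∀ n, g (a (H n)) = f (a (H n)) := fun n =>
    mapClusterPt_apply_eq_of_tendsto hg
      (tendsto_of_eventually_approx fun m hm => happ m n hm _ (by simp))
  have hgp : g p = f p := mapClusterPt_apply_eq_of_tendsto hg
    (tendsto_of_eventually_approx fun m (hm : m ≥ 0) => happ m 0 hm _ (by simp))
  -- The index `none` stands for `g`, and `some k` for `h k`.
  obtain ⟨y, ψ, hψ, hlim⟩ := hP.exists_subseq_tendsto
    (fun i : Option ℕ => (i.elim g h).restrict P) (fun n => a (H n))
  have hhy : ∀ k, h k y = h k p := fun k => by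
    refine tendsto_nhds_unique (hlim (some k)) ?_
    rw [tendsto_iff_dist_tendsto_zero]
    refine squeeze_zero' (Eventually.of_forall fun _ => dist_nonneg) ?_
      (tendsto_one_div_add_atTop_nhds_zero_nat.comp hψ.tendsto_atTop)
    filter_upwards [hψ.tendsto_atTop.eventually_gt_atTop k] with n hn
    have := hanear (H (ψ n)) (h k) (mem_history hs hn)
    rw [history_length h0 hs] at this
    exact this.le
  have hgy : g y = f p := (mapClusterPt_apply_eq_apply hg hhy).trans hgp
  have hlim' : Tendsto (fun n => dist (f (a (H (ψ n)))) (f p)) atTop (𝓝 0) := by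
    have := hlim none
    simp only [Option.elim, ContinuousMap.restrict_apply, hgf, hgy] at this
    exact tendsto_iff_dist_tendsto_zero.1 this
  exact absurd (ge_of_tendsto' hlim' fun n => hafar _) (not_le.2 hε)

/-- A sequence `h` in `Y`, with histories `H n`, all of whose chosen data can depend on the
history, and a cluster point of `h` that agrees with `f` on the pseudocompact sets `Q (H n) k`. -/
theorem PointwiseApprox.exists_history_clusterPt {Y : Set C(X, ℝ)} {f : X → ℝ}
    (hf : PointwiseApprox Y f) (hY : PointwiseSeqClustering Y)
    (Q : List C(X, ℝ) → ℕ → Set X) (hQ : ∀ l k, Pseudocompact (Q l k)) (x₀ : X) :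
    ∃ (h : ℕ → C(X, ℝ)) (H : ℕ → List C(X, ℝ)) (g : C(X, ℝ)), H 0 = [] ∧
      (∀ n, H (n + 1) = h n :: H n) ∧
      MapClusterPt (g : X → ℝ) atTop (fun n => (h n : X → ℝ)) ∧ g x₀ = f x₀ ∧
      ∀ n k, EqOn f g (Q (H n) k) := by
  classical
  have hcont : ∀ l k, ContinuousOn f (Q l k) := fun l k => hf.continuousOn hY (hQ l k)
  let fr : ∀ l k, C(Q l k, ℝ) := fun l k =>
    ⟨(Q l k).domRestrict f, continuousOn_iff_continuous_domRestrict.1 (hcont l k)⟩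
  -- The functions in `l` fix the fineness of the net; the earlier history `l'` names the set.
  -- Continuity of `f` on that set lets `f` join the functions controlled.
  have net : ∀ (l l' : List C(X, ℝ)) (k : ℕ), ∃ E : Finset X, ∀ y : Q l' k, ∃ x : Q l' k,
      (x : X) ∈ E ∧ |f x - f y| < 1 / ((l.length : ℝ) + 1) ∧
        ∀ φ ∈ l, |φ x - φ y| < 1 / ((l.length : ℝ) + 1) := fun l l' k => by
    obtain ⟨E, hE⟩ := (hQ l' k).exists_finset_net
      (fun i : Option {φ // φ ∈ l.toFinset} => i.elim (fr l' k) fun φ => φ.1.restrict (Q l' k))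
      (ε := 1 / ((l.length : ℝ) + 1)) (by positivity)
    refine ⟨E, fun y => ?_⟩
    obtain ⟨x, hx, hxy⟩ := hE y
    exact ⟨x, hx, hxy none, fun φ hφ => hxy (some ⟨φ, by simpa using hφ⟩)⟩
  choose N hN using net
  -- Only the sets with `k ≤ l.length` enter, which keeps the union finite; each set is treated from
  -- some stage on.
  obtain ⟨h, H, hhY, h0, hs, happ⟩ := exists_history hf fun l =>
    insert x₀ (l.tails.toFinset.biUnion fun l' =>
      (Finset.range (l.length + 1)).biUnion fun k => N l l' k)
  obtain ⟨g, hg⟩ := hY h hhY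
  refine ⟨h, H, g, h0, hs, hg, mapClusterPt_apply_eq_of_tendsto hg
    (tendsto_of_eventually_approx fun m (hm : m ≥ 0) => happ m 0 hm _ (by simp)), ?_⟩
  intro j k y hy
  have hlen := history_length h0 hs
  choose x hxN hxf hxφ using fun n => hN (H n) (H j) k ⟨y, hy⟩
  have hgf : ∀ n ≥ max j k, g (x n) = f (x n) := fun n hn =>
    mapClusterPt_apply_eq_of_tendsto hg <| tendsto_of_eventually_approx fun m hm =>
      happ m n hm _ <| Finset.mem_insert_of_mem <| Finset.mem_biUnion.2
        ⟨H j, by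
          obtain ⟨i, rfl⟩ := Nat.exists_eq_add_of_le (le_of_max_le_left hn)
          rw [List.mem_toFinset, List.mem_tails, ← history_drop hs j i]
          exact List.drop_suffix _ _,
        Finset.mem_biUnion.2 ⟨k, by
          rw [Finset.mem_range, hlen]; exact Nat.lt_succ_of_le (le_of_max_le_right hn),
          hxN n⟩⟩
  -- The net points `x n` approach `y` as seen by `f` and all `h i`. Their limit `z` thus has the
  -- same values as `y` there, while `g z = f z` because `g` and `f` agree at the net points.
  obtain ⟨z, ψ, hψ, hlim⟩ := (hQ (H j) k).exists_subseq_tendsto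
    (fun i : Option (Option ℕ) => i.elim (fr (H j) k) fun i => (i.elim g h).restrict (Q (H j) k)) x
  have hsmall := tendsto_one_div_add_atTop_nhds_zero_nat (𝕜 := ℝ) |>.comp hψ.tendsto_atTop
  have hfz : f z = f y := by
    refine tendsto_nhds_unique (hlim none) ?_
    rw [tendsto_iff_dist_tendsto_zero]
    refine squeeze_zero (fun _ => dist_nonneg) (fun n => ?_) hsmall
    have := hxf (ψ n)
    rw [hlen] at this
    exact this.le
  have hhz : ∀ i, h i z = h i y := fun i => by
    refine tendsto_nhds_unique (hlim (some (some i))) ?_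
    rw [tendsto_iff_dist_tendsto_zero]
    refine squeeze_zero' (Eventually.of_forall fun _ => dist_nonneg) ?_ hsmall
    filter_upwards [hψ.tendsto_atTop.eventually_gt_atTop i] with n hn
    have := hxφ (ψ n) (h i) (mem_history hs hn)
    rw [hlen] at this
    exact this.le
  have hgz : g z = f z := by
    refine tendsto_nhds_unique (hlim (some none)) ((hlim none).congr' ?_)
    filter_upwards [hψ.tendsto_atTop.eventually_ge_atTop (max j k)] with n hn
    exact (hgf _ hn).symm
  rw [← hfz, ← hgz]
  exact mapClusterPt_apply_eq_apply hg hhz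

theorem PointwiseApprox.exists_eqOn {Y : Set C(X, ℝ)} {f : X → ℝ}
    (hf : PointwiseApprox Y f) (hY : PointwiseSeqClustering Y) {P : ℕ → Set X}
    (hP : ∀ n, Pseudocompact (P n)) (x₀ : X) :
    ∃ g : C(X, ℝ), g x₀ = f x₀ ∧ EqOn f g (⋃ n, P n) := by
  obtain ⟨h, H, g, -, -, -, hg, hfg⟩ := hf.exists_history_clusterPt hY (fun _ => P)
    (fun _ => hP) x₀
  refine ⟨g, hg, fun x hx => ?_⟩
  obtain ⟨k, hk⟩ := mem_iUnion.1 hx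
  exact hfg 0 k hk

/-- Continuity of `f` on the closure is not available. For each `z` there, another continuous `g'`
agrees with `f` on the union and at `z`; by density `g'` and `g` agree at `z`. -/
theorem PointwiseApprox.eqOn_closure {Y : Set C(X, ℝ)} {f : X → ℝ}
    (hf : PointwiseApprox Y f) (hY : PointwiseSeqClustering Y) {P : ℕ → Set X}
    (hP : ∀ n, Pseudocompact (P n)) {g : C(X, ℝ)} (hg : EqOn f g (⋃ n, P n)) :
    EqOn f g (closure (⋃ n, P n)) := by
  intro z hz
  obtain ⟨g', hz', hg'⟩ := hf.exists_eqOn hY hP z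
  have : EqOn g' g (closure (⋃ n, P n)) :=
    EqOn.closure (fun x hx => (hg' hx).symm.trans (hg hx)) g'.continuous g.continuous
  rw [← hz', this hz]

/-! ### Continuity of pointwise limits on the whole space. -/

theorem FunctionallyGenerated.continuous_of_pointwiseApprox
    (hX : FunctionallyGenerated X (gammaP X)) {Y : Set C(X, ℝ)}
    (hY : PointwiseSeqClustering Y) {f : X → ℝ} (hf : PointwiseApprox Y f) : Continuous f := by
  by_contra hc
  obtain ⟨Z, ⟨D, -, hZD, P, hP, rfl⟩, hZ⟩ := hX f hc
  rcases isEmpty_or_nonempty X with hX | ⟨⟨x₀⟩⟩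
  · exact hc (continuous_of_const fun x => hX.elim x)
  obtain ⟨g, -, hg⟩ := hf.exists_eqOn hY hP x₀
  exact hZ ⟨g, fun z hz => (hf.eqOn_closure hY hP hg (hZD hz)).symm⟩

/-- If `f ⁻¹' K` is not closed, play the game at some `x` outside it while building `h`. A point `y`
in all moves of ONE has `h k y = h k x` for all `k`, so `g y = g x = f x`. The moves of TWO lie in
`f ⁻¹' K`, where `f = g` on them, so `y` in the closure of their union gives `g y ∈ K`,
contradicting `f x ∉ K`. -/
theorem IsAVSpace.continuous_of_pointwiseApprox (hX : IsAVSpace X (gammaP X))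
    {Y : Set C(X, ℝ)} (hY : PointwiseSeqClustering Y) {f : X → ℝ} (hf : PointwiseApprox Y f) :
    Continuous f := by
  rw [continuous_iff_isClosed]
  intro K hK
  by_contra hc
  obtain ⟨x, ⟨-, hxA⟩, σ, hσ⟩ := hX _ hc
  -- ONE answers the history `l` with the points at which its members are close to their value
  -- at `x`.
  let V : List C(X, ℝ) → Set X := fun l =>
    {z | ∀ φ ∈ l, |φ z - φ x| < 1 / ((l.length : ℝ) + 1)}
  have hV : ∀ l, V l ∈ 𝓝 x := fun l => by
    classical
    have : ∀ φ ∈ l.toFinset, ∀ᶠ z in 𝓝 x, |φ z - φ x| < 1 / ((l.length : ℝ) + 1) := fun φ _ =>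
      (Metric.continuousAt_iff'.1 φ.continuous.continuousAt) _ (by positivity)
    filter_upwards [(Filter.eventually_all_finset _).2 this] with z hz φ hφ
    exact hz φ (by simpa using hφ)
  -- Dropping the `l.length - i` newest entries recovers the history at time `i`.
  let S : List C(X, ℝ) → Set X := fun l =>
    σ l.length fun i => V (l.drop (l.length - i))
  have hQ : ∀ l, ∃ P : ℕ → Set X, (∀ k, Pseudocompact (P k)) ∧ S l ⊆ closure (⋃ k, P k) :=
    fun l => by
      obtain ⟨T, ⟨D, -, hTD, P, hP, rfl⟩, hT⟩ := ((hσ (fun i => V (l.drop (l.length - i)))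
        fun _ => hV _).1 l.length).2
      exact ⟨P, hP, hT.trans (closure_minimal hTD isClosed_closure)⟩
  choose Q hQp hSQ using hQ
  obtain ⟨h, H, g, h0, hs, hg, hgx, hfg⟩ := hf.exists_history_clusterPt hY Q hQp x
  have hlen := history_length h0 hs
  have hS : ∀ n, σ n (fun i => V (H i)) = S (H n) := fun n => by
    -- The type of a move depends on its index, so `(H n).length` is replaced by a variable `m`
    -- before substituting.
    have aux : ∀ m, m = n → (σ n fun i => V (H i)) = σ m fun i => V ((H n).drop (m - i)) := by
      rintro m rfl
      congr 1
      funext i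
      have := history_drop hs i (m - i)
      rw [Nat.add_sub_cancel' (Nat.lt_succ_iff.1 i.2)] at this
      rw [this]
    exact aux _ (hlen n)
  obtain ⟨hplay, y, hyS, hyV⟩ := hσ (fun n => V (H n)) fun _ => hV _
  have hhy : ∀ k, h k y = h k x := fun k => by
    have hlim : Tendsto (fun _ : ℕ => |h k y - h k x|) atTop (𝓝 0) := by
      refine squeeze_zero' (Eventually.of_forall fun _ => abs_nonneg _) ?_
        tendsto_one_div_add_atTop_nhds_zero_nat
      filter_upwards [eventually_gt_atTop k] with n hn
      have := mem_iInter.1 hyV n (h k) (mem_history hs hn)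
      rw [hlen] at this
      exact this.le
    exact sub_eq_zero.1 (abs_eq_zero.1 (tendsto_nhds_unique tendsto_const_nhds hlim))
  have hgy : g y = f x := (mapClusterPt_apply_eq_apply hg hhy).trans hgx
  have hP : ∀ n, EqOn f g (closure (⋃ k, Q (H n) k)) := fun n =>
    hf.eqOn_closure hY (hQp _) fun z hz => by
      obtain ⟨k, hk⟩ := mem_iUnion.1 hz
      exact hfg n k hk
  have hsub : (⋃ n, σ n fun i => V (H i)) ⊆ g ⁻¹' K := by
    refine iUnion_subset fun n z hz => ?_
    have hzK : f z ∈ K := (hplay n).1 hz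
    simp only [hS] at hz
    rwa [hP n (hSQ _ hz)] at hzK
  have hyK : g y ∈ K := closure_minimal hsub (hK.preimage g.continuous) hyS
  exact hxA (show f x ∈ K from hgy ▸ hyK)

end Pointwise
end AsanovVelichko

namespace AsanovVelichko

section UniformOn

variable {X : Type*} [TopologicalSpace X] {Λ : Set (Set X)}

/-! ### Uniform convergence on members of `Λ`, and compactness. -/

/-- The continuous map underlying a point of `CUnif X Λ`. -/
def CUnif.toContinuousMap (f : CUnif X Λ) : C(X, ℝ) := f

theorem CUnif.tendsto_iff {ι : Type*} {l : Filter ι} {u : ι → CUnif X Λ} {f : CUnif X Λ} :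
    Tendsto u l (𝓝 f) ↔ ∀ A ∈ Λ,
      TendstoUniformlyOn (fun i => (u i).toContinuousMap) f.toContinuousMap l A := by
  rw [show 𝓝 f = comap (fun φ : CUnif X Λ => UniformOnFun.ofFun Λ (φ.toContinuousMap : X → ℝ))
    (𝓝 (UniformOnFun.ofFun Λ f.toContinuousMap)) from nhds_induced _ _, tendsto_comap_iff,
    UniformOnFun.tendsto_iff_tendstoUniformlyOn]
  rfl

theorem CUnif.setOf_near_mem_nhds (f : CUnif X Λ) {A : Set X} (hA : A ∈ Λ) {ε : ℝ} (hε : 0 < ε) :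
    {φ : CUnif X Λ | ∀ x ∈ A, dist (f.toContinuousMap x) (φ.toContinuousMap x) < ε} ∈ 𝓝 f :=
  Metric.tendstoUniformlyOn_iff.1 (CUnif.tendsto_iff.1 (tendsto_id (x := 𝓝 f)) A hA) ε hε

theorem CUnif.continuous_coe (hΛ : ⋃₀ Λ = univ) :
    Continuous fun φ : CUnif X Λ => (φ.toContinuousMap : X → ℝ) :=
  (UniformOnFun.uniformContinuous_toFun hΛ).continuous.comp
    (continuous_induced_dom (f := fun φ : CUnif X Λ => UniformOnFun.ofFun Λ (φ.toContinuousMap : X → ℝ)))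

theorem CUnif.t2Space (hΛ : ⋃₀ Λ = univ) : T2Space (CUnif X Λ) :=
  T2Space.of_injective_continuous (fun _ _ h => DFunLike.coe_injective (F := C(X, ℝ)) h)
    (CUnif.continuous_coe hΛ)

/-- A sequence of finite range takes some value infinitely often. Otherwise an accumulation point of
the range works: in a `T1Space` each of its neighbourhoods contains infinitely many values. -/
theorem exists_mapClusterPt_of_infinite_accPt {Z : Type*} [TopologicalSpace Z] [T1Space Z]
    {Y : Set Z} (hY : ∀ A ⊆ Y, A.Infinite → ∃ z, AccPt z (𝓟 A)) {h : ℕ → Z}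
    (hh : ∀ n, h n ∈ Y) : ∃ z, MapClusterPt z atTop h := by
  by_cases hfin : (range h).Finite
  · have : ∃ z ∈ range h, ∃ᶠ n in atTop, h n = z := by
      by_contra hcon
      simp only [not_exists, not_and, not_frequently] at hcon
      obtain ⟨n, hn⟩ := ((hfin.eventually_all).2 hcon).exists
      exact hn _ (mem_range_self n) rfl
    obtain ⟨z, -, hz⟩ := this
    exact ⟨z, mapClusterPt_iff_frequently.2 fun s hs => hz.mono fun n hn =>
      hn ▸ mem_of_mem_nhds hs⟩
  · obtain ⟨z, hz⟩ := hY (range h) (range_subset_iff.2 hh) hfin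
    refine ⟨z, mapClusterPt_iff_frequently.2 fun s hs => ?_⟩
    have hinf : (range h ∩ s).Infinite := by
      intro hf
      rw [accPt_iff_frequently] at hz
      have hmem : ((range h ∩ s) \ {z})ᶜ ∈ 𝓝 z :=
        (hf.subset sdiff_subset).isClosed.isOpen_compl.mem_nhds (by simp)
      obtain ⟨y, ⟨hyz, hyr⟩, hys, hyc⟩ := (hz.and_eventually (Filter.inter_mem hs hmem)).exists
      exact hyc ⟨⟨hyr, hys⟩, hyz⟩
    rw [Nat.frequently_atTop_iff_infinite]
    intro hf
    refine hinf ((hf.image h).subset ?_)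
    rintro _ ⟨⟨n, rfl⟩, hn⟩
    exact ⟨n, hn, rfl⟩

/-- If pointwise limits of `Y` are continuous and sequences in `Y` cluster, then every ultrafilter
on `Y` converges. -/
theorem CUnif.exists_ultrafilter_le_nhds (hΛ : ⋃₀ Λ = univ) {Y : Set (CUnif X Λ)}
    (hY : ∀ h : ℕ → CUnif X Λ, (∀ n, h n ∈ Y) → ∃ g, MapClusterPt g atTop h)
    (hcont : ∀ f : X → ℝ, PointwiseApprox (X := X) Y f → Continuous f)
    (𝒰 : Ultrafilter (CUnif X Λ)) (h𝒰 : Y ∈ 𝒰) : ∃ f : CUnif X Λ,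
      (𝒰 : Filter (CUnif X Λ)) ≤ 𝓝 f := by
  classical
  let ev : CUnif X Λ → X → ℝ := fun φ => φ.toContinuousMap
  have hcl : ∀ {h : ℕ → CUnif X Λ} {g : CUnif X Λ}, MapClusterPt g atTop h →
      MapClusterPt (ev g) atTop fun n => ev (h n) := fun hg =>
    hg.continuousAt_comp (CUnif.continuous_coe hΛ).continuousAt
  -- Otherwise some sequence in `Y` is unbounded at `x` along every subsequence, and cannot cluster.
  have hbdd : ∀ x, ∃ M : ℕ, ∀ φ ∈ Y, |ev φ x| ≤ M := by
    intro x
    by_contra hcon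
    push Not at hcon
    choose h hhY hh using hcon
    obtain ⟨g, hg⟩ := hY h hhY
    have h1 : MapClusterPt |ev g x| atTop fun n => |ev (h n) x| :=
      (hcl hg).continuousAt_comp (f := fun u : X → ℝ => |u x|)
        (by fun_prop : Continuous fun u : X → ℝ => |u x|).continuousAt
    have h2 := mapClusterPt_iff_frequently.1 h1 (Iio (|ev g x| + 1)) (Iio_mem_nhds (by linarith))
    obtain ⟨N, hN⟩ := exists_nat_gt (|ev g x| + 1)
    obtain ⟨n, hn, hNn⟩ := (h2.and_eventually (eventually_ge_atTop N)).exists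
    have : (N : ℝ) ≤ n := by exact_mod_cast hNn
    have := hh n
    simp only [mem_Iio] at hn
    linarith
  choose M hM using hbdd
  have hlim : ∃ f : X → ℝ, Tendsto ev 𝒰 (𝓝 f) := by
    have hK : IsCompact (univ.pi fun x => Icc (-(M x : ℝ)) (M x)) :=
      isCompact_univ_pi fun _ => isCompact_Icc
    obtain ⟨f, -, hf⟩ := hK.ultrafilter_le_nhds (𝒰.map ev) <| by
      rw [le_principal_iff]
      exact Ultrafilter.mem_coe.2 <| Ultrafilter.mem_map.2 <| mem_of_superset h𝒰
        fun φ hφ x _ => abs_le.1 (hM x φ hφ)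
    exact ⟨f, hf⟩
  obtain ⟨f, hf⟩ := hlim
  have happrox : ∀ W ∈ 𝒰, PointwiseApprox (X := X) W f := fun W hW E ε hε => by
    have h1 : ∀ x ∈ E, ∀ᶠ φ in (𝒰 : Filter (CUnif X Λ)), dist (ev φ x) (f x) < ε := fun x _ =>
      (Metric.tendsto_nhds.1 (tendsto_pi_nhds.1 hf x)) ε hε
    obtain ⟨φ, hφ, hφW⟩ := (((Filter.eventually_all_finset E).2 h1).and hW).exists
    exact ⟨φ, hφW, fun x hx => hφ x hx⟩
  let f' : CUnif X Λ := (⟨f, hcont f (happrox Y h𝒰)⟩ : C(X, ℝ))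
  refine ⟨f', ?_⟩
  change Tendsto id (𝒰 : Filter (CUnif X Λ)) (𝓝 _)
  rw [CUnif.tendsto_iff]
  intro A hA
  rw [Metric.tendstoUniformlyOn_iff]
  intro ε hε
  by_contra hnot
  -- `W` belongs to the ultrafilter, so `f` is still a pointwise limit of `W`.
  let W : Set (CUnif X Λ) := {φ | φ ∈ Y ∧ ∃ a ∈ A, ε ≤ dist (f a) (ev φ a)}
  have hW : W ∈ 𝒰 := by
    have := Ultrafilter.eventually_not.2 hnot
    filter_upwards [this, h𝒰] with φ hφ hφY
    push Not at hφ
    exact ⟨hφY, hφ⟩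
  have hfar : ∀ φ : C(X, ℝ), ∃ a : Option X, φ ∈ (W : Set C(X, ℝ)) →
      ∃ b ∈ A, a = some b ∧ ε ≤ dist (f b) (φ b) := fun φ => by
    by_cases h : φ ∈ (W : Set C(X, ℝ))
    · obtain ⟨-, b, hb, hb'⟩ := id h
      exact ⟨some b, fun _ => ⟨b, hb, rfl, hb'⟩⟩
    · exact ⟨none, fun h' => (h h').elim⟩
  choose a ha using hfar
  -- All `h m` with `m > n` approximate `f` at the witness `b n` of `h n`, so `g (b n) = f (b n)`.
  -- But some `h n` is within `ε` of `g` on `A`, hence of `f` at `b n`.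
  obtain ⟨h, H, hhW, h0, hs, hnear⟩ := exists_history (happrox W hW)
    fun l : List C(X, ℝ) => l.toFinset.biUnion fun φ => (a φ).toFinset
  obtain ⟨g, hg⟩ := hY h fun n => (hhW n).1
  choose b hbA hb hbfar using fun n => ha (h n) (hhW n)
  have hgf : ∀ n, ev g (b n) = f (b n) := fun n =>
    mapClusterPt_apply_eq_of_tendsto (hcl hg) <| tendsto_of_eventually_approx fun m hm =>
      hnear m (n + 1) hm (b n) <| Finset.mem_biUnion.2
        ⟨h n, by simp [hs], by simp [hb]⟩
  obtain ⟨n, hn⟩ :=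
    (mapClusterPt_iff_frequently.1 hg _ (CUnif.setOf_near_mem_nhds g hA hε)).exists
  have h1 : dist (ev g (b n)) (h n (b n)) < ε := hn (b n) (hbA n)
  rw [hgf] at h1
  exact (hbfar n).not_gt h1

/-- An ultrafilter `𝒢` on the closure is moved to `Y` through the sets that are neighbourhoods of
`𝒢`-almost every point. The limit `f` found there is a limit of `𝒢`: a closed neighbourhood of `f`
outside `𝒢` would have its open complement among those sets. -/
theorem isCompact_closure_of_ultrafilter {Z : Type*} [TopologicalSpace Z] [RegularSpace Z]
    {Y : Set Z} (hY : ∀ 𝒰 : Ultrafilter Z, Y ∈ 𝒰 → ∃ z, (𝒰 : Filter Z) ≤ 𝓝 z) : IsCompact (closure Y) := by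
  rw [isCompact_iff_ultrafilter_le_nhds]
  intro 𝒢 h𝒢
  rw [le_principal_iff] at h𝒢
  have hne : ((𝒢 : Filter Z).bind 𝓝 ⊓ 𝓟 Y).NeBot := by
    rw [inf_principal_neBot_iff]
    intro s hs
    obtain ⟨z, hz, hzY⟩ := 𝒢.nonempty_of_mem (inter_mem (mem_bind'.1 hs) h𝒢)
    exact mem_closure_iff_nhds.1 hzY s hz
  obtain ⟨f, hf⟩ := hY (Ultrafilter.of ((𝒢 : Filter Z).bind 𝓝 ⊓ 𝓟 Y))
    (le_principal_iff.1 ((Ultrafilter.of_le _).trans inf_le_right))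
  have h𝒢f : (𝒢 : Filter Z) ≤ 𝓝 f := by
    refine (closed_nhds_basis f).ge_iff.2 fun N hN => ?_
    by_contra hN𝒢
    have hc : Nᶜ ∈ (𝒢 : Filter Z).bind 𝓝 := mem_bind'.2 <|
      mem_of_superset (Ultrafilter.compl_mem_iff_notMem.2 hN𝒢) fun z hz =>
        hN.2.isOpen_compl.mem_nhds hz
    exact Ultrafilter.compl_notMem_iff.2 (hf hN.1)
      ((Ultrafilter.of_le _).trans inf_le_left hc)
  exact ⟨f, isClosed_closure.mem_of_tendsto (f := id) h𝒢f h𝒢, h𝒢f⟩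

end UniformOn

end AsanovVelichko

theorem corollary2p13 {X : Type*} [TopologicalSpace X] [T35Space X]
    (Λ : Set (Set X)) (hΛ : ⋃₀ Λ = Set.univ)
    (hX : AsanovVelichko.IsAVSpace X (AsanovVelichko.gammaP X) ∨
      AsanovVelichko.FunctionallyGenerated X (AsanovVelichko.gammaP X))
    (F : Set (AsanovVelichko.CUnif X Λ)) (hF : AsanovVelichko.CountablyPracompact F) :
    AsanovVelichko.RelativelyCompact F := by
  obtain ⟨Y, -, hFY, hacc⟩ := hF
  have := AsanovVelichko.CUnif.t2Space hΛ
  have hY : ∀ h : ℕ → AsanovVelichko.CUnif X Λ, (∀ n, h n ∈ Y) → ∃ g, MapClusterPt g atTop h :=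
    fun h hh => AsanovVelichko.exists_mapClusterPt_of_infinite_accPt
      (fun A hA hA' => (hacc A hA hA').imp fun _ => And.right) hh
  have hYp : AsanovVelichko.PointwiseSeqClustering (X := X) Y := fun h hh => by
    obtain ⟨g, hg⟩ := hY h hh
    exact ⟨g, hg.continuousAt_comp
      (AsanovVelichko.CUnif.continuous_coe hΛ).continuousAt⟩
  have hcont : ∀ f : X → ℝ, AsanovVelichko.PointwiseApprox (X := X) Y f → Continuous f :=
    fun f hf => hX.elim (fun h => h.continuous_of_pointwiseApprox hYp hf)
      fun h => h.continuous_of_pointwiseApprox hYp hf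
  exact (AsanovVelichko.isCompact_closure_of_ultrafilter
    (AsanovVelichko.CUnif.exists_ultrafilter_le_nhds hΛ hY hcont)).of_isClosed_subset
    isClosed_closure (closure_minimal hFY isClosed_closure)
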